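/- Let $\omega_1,\omega_2\in\mathbb{C}$ be $\mathbb{R}$-linearly independent, let $\Omega=\mathbb{Z}\omega_1+\mathbb{Z}\omega_2$, and let $$\sigma_\Omega(z)=z\prod_{\omega\in\Omega\setminus\{0\}}\left(1-\frac{z}{\omega}\right)\exp\left(\frac{z}{\omega}+\frac{z^2}{2\omega^2}\right)$$ be its Weierstrass $\sigma$-function. Suppose that $\tau=\omega_2/\omega_1$ satisfies $\operatorname{Im}(\tau)>0$, $|\tau|\geq 1$ and $-\frac12\leq\operatorname{Re}(\tau)\leq\frac12$, and let $P$ be the closed region in $\mathbb{C}$ enclosed by the parallelogram with vertices $\frac{\pm\omega_1\pm\omega_2}{2}$. If $\operatorname{Im}(\tau)\leq 1.9$, then there are positive real constants $r$ and $c$, effectively computable from $\omega_1$ and $\omega_2$, such that for every $z\in\mathbb{C}$ with $|z|\geq r$ there exists $z_0\in P$ with $z-z_0\in\Omega$ and $$|\sigma_\Omega(z)|\geq|\sigma_\Omega(z_0)|\,e^{c|z|^2}.$$ Here "effectively computable from $\omega_1$ and $\omega_2$" means that $r=r(\omega_1,\omega_2)$ and $c=c(\omega_1,\omega_2)$ are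 computable functions in the sense of computable analysis on the set of all pairs $(\omega_1,\omega_2)$ as above with $\operatorname{Im}(\tau)\leq 1.9$: for each of the two there is a single algorithm which, given $k\in\mathbb{N}$ and any sequences of dyadic approximations to the real and imaginary parts of $\omega_1$ and $\omega_2$ (the $n$-th terms being of the form $a/2^n$ with $a\in\mathbb{Z}$ and having error at most $2^{-n}$), outputs after reading finitely many terms an integer $b$ such that $b/2^k$ approximates the constant with error at most $2^{-k}$. -/

import Mathlib

noncomputable section

namespace PeriodPair

/-- The Weierstrass sigma function
`σ_Ω(z) = z ∏_{ω ∈ Ω, ω ≠ 0} (1 - z/ω) exp (z/ω + z²/(2ω²))` of the lattice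
`Ω = ℤ ω₁ + ℤ ω₂`. -/
def weierstrassSigma (L : PeriodPair) (z : ℂ) : ℂ :=
  z * ∏' ω : {ω : L.lattice // ω ≠ 0},
    (1 - z / (ω.1 : ℂ)) * Complex.exp (z / (ω.1 : ℂ) + z ^ 2 / (2 * (ω.1 : ℂ) ^ 2))

/-- The ratio `τ = ω₂ / ω₁` of the periods. -/
def tau (L : PeriodPair) : ℂ := L.ω₂ / L.ω₁

/-- The pair of periods is reduced: `τ` lies in the upper half plane, has modulus at least `1`
and real part in `[-1/2, 1/2]`. -/
def IsReduced (L : PeriodPair) : Prop :=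
  0 < L.tau.im ∧ 1 ≤ ‖L.tau‖ ∧ L.tau.re ∈ Set.Icc (-(1 / 2) : ℝ) (1 / 2)

/-- The closed region enclosed by the parallelogram with vertices `(± ω₁ ± ω₂) / 2`. -/
def centredParallelogram (L : PeriodPair) : Set ℂ :=
  {w | ∃ s ∈ Set.Icc (-(1 / 2) : ℝ) (1 / 2), ∃ t ∈ Set.Icc (-(1 / 2) : ℝ) (1 / 2),
    w = (s : ℂ) * L.ω₁ + (t : ℂ) * L.ω₂}

end PeriodPair

/-- The integer `a` is an approximation of the real number `x` to within `2⁻ⁿ`, in the sense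
that `|x - a / 2ⁿ| ≤ 1 / 2ⁿ`. -/
def IsDyadicApprox (x : ℝ) (n : ℕ) (a : ℤ) : Prop :=
  |x - (a : ℝ) / 2 ^ n| ≤ 1 / 2 ^ n

/-- The data on a pair of periods that an algorithm can read: the `n`-th entry gives
approximations to within `2⁻ⁿ` of `Re ω₁`, `Im ω₁`, `Re ω₂`, `Im ω₂`. -/
def IsPeriodName (L : PeriodPair) (p : ℕ → (ℤ × ℤ) × (ℤ × ℤ)) : Prop :=
  ∀ n, IsDyadicApprox L.ω₁.re n (p n).1.1 ∧ IsDyadicApprox L.ω₁.im n (p n).1.2 ∧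
    IsDyadicApprox L.ω₂.re n (p n).2.1 ∧ IsDyadicApprox L.ω₂.im n (p n).2.2

/-- The quantity `g(ω₁, ω₂)` is effectively computable from `(ω₁, ω₂)` on the set `D` of pairs of
periods, in the usual sense of computable analysis: there is one algorithm `M` for all pairs in
`D` which, given a precision `k` and reading longer and longer initial segments of any sequence
of approximations to `ω₁` and `ω₂`, eventually outputs an approximation of `g(ω₁, ω₂)` to within
`2⁻ᵏ`. The value `none` means that `M` has to read further before it can answer; every answer
that it gives is correct. Nothing is required for pairs of periods outside `D`. -/
def IsEffectiveOn (D : Set PeriodPair) (g : PeriodPair → ℝ) : Prop :=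
  ∃ M : List ((ℤ × ℤ) × (ℤ × ℤ)) → ℕ → Option ℤ, Computable₂ M ∧
    ∀ L ∈ D, ∀ p, IsPeriodName L p → ∀ k : ℕ,
      (∃ n a, M ((List.range n).map p) k = some a) ∧
      ∀ n a, M ((List.range n).map p) k = some a → IsDyadicApprox (g L) k a

end

/-! Put `z = ω₁ u` and `y = Im τ`. Pairing `ω` with `-ω` and multiplying row by row (Eisenstein
order) turns `σ²` into `ω₁² exp (u² G2 τ) θ(u)`, where `θ` (`sqTheta`) is a limit of squared sine
products (`exists_tendsto_sqTheta`). Hence `θ` has period 1 and an explicit multiplier under `u ↦ u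
+ τ`, so `|θ(u)| exp (-2π (Im u)² / y)` (`reducedNorm`) is doubly periodic.

Since `2 (Im u)² = |u|² - Re u²`, `|σ|²` equals a periodic function times the exponential of `Re
((G2 τ - π/y) u²) + (π/y) |u|²` (`norm_weierstrassSigma_sq`). This form is positive definite when
`|G2 τ - π/y| < π/y`, which the `q`-expansion of `G2` gives for `0.86 ≤ y ≤ 1.9`
(`norm_G2_sub_pi_div_im_le`). For congruent `z` and `z₀` the periodic factors cancel: the exponent
is bounded at `z₀` and grows quadratically at `z`.

The constants depend only on `|Re ω₁| + |Im ω₁|`, which dominates `‖ω₁‖` and is easily computed. -/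

/-! ### Computability of the two constants. -/

theorem Int.natAbs_eq_encode (x : ℤ) : x.natAbs = (Encodable.encode x + 1) / 2 := by
  rcases x with n | n
  · change n = (2 * n + 1) / 2
    omega
  · change n + 1 = (2 * n + 1 + 1) / 2
    omega

theorem Primrec.int_natAbs : Primrec Int.natAbs :=
  (Primrec.nat_div.comp (Primrec.succ.comp Primrec.encode) (Primrec.const 2)).of_eq
    fun x => (Int.natAbs_eq_encode x).symm

theorem Primrec.int_natCast : Primrec (fun n : ℕ => (n : ℤ)) := by
  refine ((Primrec.ofNat ℤ).comp (Primrec.nat_mul.comp (Primrec.const 2) Primrec.id)).of_eq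
    fun n => ?_
  have h : Encodable.encode (n : ℤ) = 2 * n := rfl
  change Denumerable.ofNat ℤ (2 * n) = n
  rw [← h, Denumerable.ofNat_encode]

theorem Primrec.nat_pow : Primrec₂ (fun a b : ℕ => a ^ b) := by
  refine (Primrec.nat_rec' (f := fun p : ℕ × ℕ => p.2) (g := fun _ => 1)
    (h := fun p q => p.1 * q.2) Primrec.snd (Primrec.const 1) ?_).of_eq fun p => ?_
  · exact Primrec.nat_mul.comp (Primrec.fst.comp Primrec.fst) (Primrec.snd.comp Primrec.snd)
  · induction p.2 with
    | zero => rfl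
    | succ n ih =>
      change p.1 * _ = p.1 ^ (n + 1)
      rw [pow_succ']
      exact congrArg _ ih

/-- A function of `|Re ω₁| + |Im ω₁|` is effective as soon as it can be computed from a dyadic
approximation of its argument whose precision depends on the precision of the output only. -/
theorem isEffectiveOn_of_approx (D : Set PeriodPair) (G : ℝ → ℝ) (f : ℕ → ℕ → ℕ)
    (hf : Primrec₂ f)
    (h : ∀ (s : ℝ) (A k : ℕ), 0 ≤ s → |s - A / 2 ^ (k + 10)| ≤ 2 / 2 ^ (k + 10) →
      IsDyadicApprox (G s) k (f A k)) :
    IsEffectiveOn D (fun L => G (|L.ω₁.re| + |L.ω₁.im|)) := by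
  -- Only entry `k + 10` is read; shorter prefixes give `none`. Its two errors of `2⁻⁽ᵏ⁺¹⁰⁾` account
  -- for the `2` in the hypothesis `h`.
  refine ⟨fun l k => (l[k + 10]?).map
    fun q => ((f (q.1.1.natAbs + q.1.2.natAbs) k : ℕ) : ℤ), ?_, ?_⟩
  · have h1 : Primrec₂ fun (l : List ((ℤ × ℤ) × (ℤ × ℤ))) (k : ℕ) => l[k + 10]? :=
      Primrec.list_getElem?.comp Primrec.fst
        (Primrec.nat_add.comp Primrec.snd (Primrec.const 10))
    have hq : Primrec fun x : (List ((ℤ × ℤ) × (ℤ × ℤ)) × ℕ) × ((ℤ × ℤ) × (ℤ × ℤ)) => x.2.1 :=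
      Primrec.fst.comp Primrec.snd
    have h2 : Primrec₂ fun (x : List ((ℤ × ℤ) × (ℤ × ℤ)) × ℕ) (q : (ℤ × ℤ) × (ℤ × ℤ)) =>
        ((f (q.1.1.natAbs + q.1.2.natAbs) x.2 : ℕ) : ℤ) :=
      Primrec.int_natCast.comp (hf.comp (Primrec.nat_add.comp
        (Primrec.int_natAbs.comp (Primrec.fst.comp hq))
        (Primrec.int_natAbs.comp (Primrec.snd.comp hq))) (Primrec.snd.comp Primrec.fst))
    exact (Primrec.option_map h1 h2).to_comp
  · intro L _ p hp k
    have key : IsDyadicApprox (G (|L.ω₁.re| + |L.ω₁.im|)) k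
        ((f ((p (k + 10)).1.1.natAbs + (p (k + 10)).1.2.natAbs) k : ℕ) : ℤ) := by
      refine h _ _ _ (by positivity) ?_
      obtain ⟨h1, h2, -, -⟩ := hp (k + 10)
      unfold IsDyadicApprox at h1 h2
      have aux : ∀ (x : ℝ) (a : ℤ), |x - a / 2 ^ (k + 10)| ≤ 1 / 2 ^ (k + 10) →
          |(|x| - (a.natAbs : ℝ) / 2 ^ (k + 10))| ≤ 1 / 2 ^ (k + 10) := by
        intro x a hx
        refine le_trans ?_ hx
        have : ((a.natAbs : ℝ)) / 2 ^ (k + 10) = |(a : ℝ) / 2 ^ (k + 10)| := by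
          rw [abs_div, Nat.cast_natAbs, Int.cast_abs, abs_of_pos (by positivity : (0 : ℝ) < 2 ^ (k + 10))]
        rw [this]
        exact abs_abs_sub_abs_le _ _
      have e1 := aux _ _ h1
      have e2 := aux _ _ h2
      push_cast
      calc _ = |(|L.ω₁.re| - ((p (k + 10)).1.1.natAbs : ℝ) / 2 ^ (k + 10)) +
              (|L.ω₁.im| - ((p (k + 10)).1.2.natAbs : ℝ) / 2 ^ (k + 10))| := by
            congr 1; ring
        _ ≤ _ := (abs_add_le _ _).trans (add_le_add e1 e2)
        _ = _ := by ring
    refine ⟨⟨k + 11, ((f ((p (k + 10)).1.1.natAbs + (p (k + 10)).1.2.natAbs) k : ℕ) : ℤ), ?_⟩, ?_⟩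
    · simp
    · intro n a ha
      simp only [Option.map_eq_some_iff] at ha
      obtain ⟨q, hq, rfl⟩ := ha
      rw [List.getElem?_map, Option.map_eq_some_iff] at hq
      obtain ⟨j, hj, rfl⟩ := hq
      obtain ⟨hj1, rfl⟩ := List.getElem?_eq_some_iff.1 hj
      simpa using key

/-- The quotient is `⌊N/d + 1/2⌋`, rounding to nearest in integer arithmetic. -/
theorem abs_sub_natCast_add_half_div_le (N d : ℕ) (hd : 0 < d) :
    |(N : ℝ) / d - (((2 * N + d) / (2 * d) : ℕ) : ℝ)| ≤ 1 / 2 := by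
  have h1 := Nat.div_add_mod (2 * N + d) (2 * d)
  have h2 := Nat.mod_lt (2 * N + d) (by positivity : 2 * d > 0)
  set b := (2 * N + d) / (2 * d)
  set m := (2 * N + d) % (2 * d)
  have h1' : (2 * d * b + m : ℝ) = 2 * N + d := by exact_mod_cast h1
  have h2' : (m : ℝ) < 2 * d := by exact_mod_cast h2
  have h3 : (0 : ℝ) ≤ m := by positivity
  have hd' : (0 : ℝ) < d := by exact_mod_cast hd
  have : (N : ℝ) / d - b = (m - d) / (2 * d) := by
    field_simp; linarith
  rw [this, abs_le]
  constructor
  · rw [le_div_iff₀ (by positivity)]; linarith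
  · rw [div_le_iff₀ (by positivity)]; linarith

theorem IsDyadicApprox.of_scaled {x : ℝ} {k : ℕ} {a : ℤ} (h : |x * 2 ^ k - a| ≤ 1) :
    IsDyadicApprox x k a := by
  have h2 : (0 : ℝ) < 2 ^ k := by positivity
  have : x - a / 2 ^ k = (x * 2 ^ k - a) / 2 ^ k := by field_simp
  rw [IsDyadicApprox, this, abs_div, abs_of_pos h2]
  gcongr

theorem isEffectiveOn_radius (D : Set PeriodPair) :
    IsEffectiveOn D (fun L => 128 * (|L.ω₁.re| + |L.ω₁.im|)) := by
  refine isEffectiveOn_of_approx D (fun s => 128 * s) (fun A _ => (2 * A + 8) / (2 * 8)) ?_ ?_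
  · exact Primrec.nat_div.comp (Primrec.nat_add.comp
      (Primrec.nat_mul.comp (Primrec.const 2) Primrec.fst) (Primrec.const 8)) (Primrec.const _)
  · intro s A k _ h
    refine IsDyadicApprox.of_scaled ?_
    have h2 := abs_sub_natCast_add_half_div_le A 8 (by norm_num)
    have hk : (0 : ℝ) < 2 ^ k := by positivity
    -- Input error `1/4` plus rounding error `1/2` stays below the allowed `1`.
    have h3 : |128 * s * 2 ^ k - A / 8| ≤ 1 / 4 := by
      have : 128 * s * 2 ^ k - A / 8 = (s - A / 2 ^ (k + 10)) * (128 * 2 ^ k) := by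
        rw [pow_add]; field_simp; ring
      rw [this, abs_mul, abs_of_pos (by positivity : (0 : ℝ) < 128 * 2 ^ k)]
      calc _ ≤ 2 / 2 ^ (k + 10) * (128 * 2 ^ k : ℝ) := by gcongr
        _ = 1 / 4 := by rw [pow_add]; field_simp; norm_num
    set b := (2 * A + 8) / (2 * 8)
    rw [Nat.cast_ofNat] at h2
    rw [Int.cast_natCast]
    have := abs_add_le (128 * s * 2 ^ k - A / 8) ((A : ℝ) / 8 - (b : ℝ))
    rw [sub_add_sub_cancel] at this
    linarith

theorem abs_inv_sq_sub_inv_sq_le {x y : ℝ} (hx : 1 ≤ x) (hy : 1 ≤ y) :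
    |1 / x ^ 2 - 1 / y ^ 2| ≤ 2 * |x - y| := by
  have hx0 : 0 < x := by linarith
  have hy0 : 0 < y := by linarith
  have e : 1 / x ^ 2 - 1 / y ^ 2 = (y - x) * ((x + y) / (x ^ 2 * y ^ 2)) := by
    field_simp; ring
  rw [e, abs_mul, abs_sub_comm, mul_comm]
  gcongr
  rw [abs_of_pos (by positivity), div_le_iff₀ (by positivity)]
  have h1 : x ≤ x ^ 2 := by nlinarith
  have h2 : y ≤ y ^ 2 := by nlinarith
  nlinarith [mul_nonneg (by linarith : 0 ≤ x ^ 2 - 1) (sq_nonneg y),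
    mul_nonneg (sq_nonneg x) (by linarith : 0 ≤ y ^ 2 - 1)]

/-- The `1 +` keeps the denominator away from zero, so the inverse square is uniformly Lipschitz and
the input precision can depend on `k` alone. -/
theorem isEffectiveOn_rate (D : Set PeriodPair) :
    IsEffectiveOn D (fun L => 1 / 1024 * (1 / (1 + (|L.ω₁.re| + |L.ω₁.im|)) ^ 2)) := by
  refine isEffectiveOn_of_approx D (fun s => 1 / 1024 * (1 / (1 + s) ^ 2))
    (fun A k => (2 * (2 ^ k * (2 ^ (k + 10)) ^ 2) + 1024 * (2 ^ (k + 10) + A) ^ 2) /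
      (2 * (1024 * (2 ^ (k + 10) + A) ^ 2))) ?_ ?_
  · have hk : Primrec fun x : ℕ × ℕ => 2 ^ x.2 := Primrec.nat_pow.comp (Primrec.const 2) Primrec.snd
    have hk' : Primrec fun x : ℕ × ℕ => 2 ^ (x.2 + 10) :=
      Primrec.nat_pow.comp (Primrec.const 2) (Primrec.nat_add.comp Primrec.snd (Primrec.const 10))
    have hd : Primrec fun x : ℕ × ℕ => 1024 * (2 ^ (x.2 + 10) + x.1) ^ 2 :=
      Primrec.nat_mul.comp (Primrec.const _) (Primrec.nat_pow.comp
        (Primrec.nat_add.comp hk' Primrec.fst) (Primrec.const 2))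
    exact Primrec.nat_div.comp (Primrec.nat_add.comp (Primrec.nat_mul.comp (Primrec.const 2)
      (Primrec.nat_mul.comp hk (Primrec.nat_pow.comp hk' (Primrec.const 2)))) hd)
      (Primrec.nat_mul.comp (Primrec.const 2) hd)
  · intro s A k hs h
    refine IsDyadicApprox.of_scaled ?_
    have h2 := abs_sub_natCast_add_half_div_le (2 ^ k * (2 ^ (k + 10)) ^ 2)
      (1024 * (2 ^ (k + 10) + A) ^ 2) (by positivity)
    set b := (2 * (2 ^ k * (2 ^ (k + 10)) ^ 2) + 1024 * (2 ^ (k + 10) + A) ^ 2) /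
      (2 * (1024 * (2 ^ (k + 10) + A) ^ 2))
    push_cast at h2 ⊢
    set t : ℝ := A / 2 ^ (k + 10) with ht
    have ht0 : 0 ≤ t := by positivity
    have hA : (A : ℝ) = t * 2 ^ (k + 10) := by rw [ht]; field_simp
    have hP : (0 : ℝ) < 2 ^ (k + 10) := by positivity
    have e : (2 ^ k * (2 ^ (k + 10)) ^ 2 : ℝ) / (1024 * (2 ^ (k + 10) + A) ^ 2) =
        1 / 1024 * (1 / (1 + t) ^ 2) * 2 ^ k := by
      rw [hA]; field_simp
    rw [e] at h2
    have h3 := abs_inv_sq_sub_inv_sq_le (x := 1 + s) (y := 1 + t) (by linarith) (by linarith)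
    rw [add_sub_add_left_eq_sub] at h3
    have hk : (0 : ℝ) < 2 ^ k := by positivity
    have h4 : |1 / 1024 * (1 / (1 + s) ^ 2) * 2 ^ k - 1 / 1024 * (1 / (1 + t) ^ 2) * 2 ^ k| ≤
        1 / 4 := by
      rw [← sub_mul, ← mul_sub, abs_mul, abs_mul, abs_of_pos hk, abs_of_pos (by norm_num)]
      calc _ ≤ 1 / 1024 * (2 * (2 / 2 ^ (k + 10))) * (2 ^ k : ℝ) := by
            gcongr
            exact h3.trans (by gcongr)
        _ ≤ 1 / 4 := by rw [pow_add]; field_simp; norm_num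
    have := abs_add_le (1 / 1024 * (1 / (1 + s) ^ 2) * 2 ^ k - 1 / 1024 * (1 / (1 + t) ^ 2) * 2 ^ k)
      (1 / 1024 * (1 / (1 + t) ^ 2) * 2 ^ k - (b : ℝ))
    rw [sub_add_sub_cancel] at this
    linarith

/-! ### Numerical bound for the Eisenstein series `G2`. -/

section

open scoped ArithmeticFunction.sigma

namespace EisensteinSeries

theorem sigma_one_succ_le_four_pow (n : ℕ) : σ 1 (n + 1) ≤ 4 ^ n := by
  refine (ArithmeticFunction.sigma_le_pow_succ 1 (n + 1)).trans ?_
  have h : n + 1 ≤ 2 ^ n := Nat.lt_two_pow_self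
  calc (n + 1) ^ 2 ≤ (2 ^ n) ^ 2 := Nat.pow_le_pow_left h 2
    _ = 4 ^ n := by rw [← pow_mul, mul_comm, pow_mul]; norm_num

/-- Comparison with a geometric series of ratio `4 ‖q‖`. -/
theorem norm_tsum_sigma_one_mul_pow_le {q : ℂ} (hq : 4 * ‖q‖ < 1) :
    ‖∑' n : ℕ+, (σ 1 n : ℂ) * q ^ (n : ℕ)‖ ≤ ‖q‖ / (1 - 4 * ‖q‖) := by
  rw [tsum_pnat_eq_tsum_succ (f := fun n => (σ 1 n : ℂ) * q ^ n)]
  have hg := (hasSum_geometric_of_lt_one (by positivity) hq).mul_left ‖q‖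
  rw [← div_eq_mul_inv] at hg
  refine tsum_of_norm_bounded hg fun n => ?_
  rw [norm_mul, norm_pow, Complex.norm_natCast, mul_pow]
  have : (σ 1 (n + 1) : ℝ) ≤ 4 ^ n := by exact_mod_cast sigma_one_succ_le_four_pow n
  calc _ ≤ (4 : ℝ) ^ n * ‖q‖ ^ (n + 1) := by gcongr
    _ = _ := by ring

theorem norm_cexp_two_pi_I_mul (z : UpperHalfPlane) :
    ‖Complex.exp (2 * Real.pi * Complex.I * z)‖ = Real.exp (-(2 * Real.pi * z.im)) := by
  rw [Complex.norm_exp]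
  congr 1
  simp

/-- If `Im z` lies between `0.86` and `1.9` then the real number `π / Im z` exceeds the absolute
value of the non-holomorphic Eisenstein series `G₂(z) - π / Im z` by a definite amount. -/
theorem norm_G2_sub_pi_div_im_le {z : UpperHalfPlane} (h1 : 0.86 ≤ z.im) (h2 : z.im ≤ 1.9) :
    ‖G2 z - (Real.pi / z.im : ℝ)‖ + 1 / 200 ≤ Real.pi / z.im := by
  have hp1 := Real.pi_gt_d4
  have hp2 := Real.pi_lt_d4
  have hy : 0 < z.im := z.im_pos
  set q := Complex.exp (2 * Real.pi * Complex.I * z) with hq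
  set S := ∑' n : ℕ+, (σ 1 n : ℂ) * q ^ (n : ℕ) with hS
  have hG : G2 z - (Real.pi / z.im : ℝ) =
      ((Real.pi ^ 2 / 3 - Real.pi / z.im : ℝ) : ℂ) - 8 * Real.pi ^ 2 * S := by
    rw [G2_eq_tsum_cexp, riemannZeta_two]
    push_cast
    ring
  have hn : ‖G2 z - (Real.pi / z.im : ℝ)‖ ≤
      |Real.pi ^ 2 / 3 - Real.pi / z.im| + 8 * Real.pi ^ 2 * ‖S‖ := by
    rw [hG]
    refine (norm_sub_le _ _).trans (le_of_eq ?_)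
    rw [Complex.norm_real, Real.norm_eq_abs]
    simp [abs_of_pos Real.pi_pos]
  have hSle : ∀ (m : ℕ) (ε : ℝ), (m : ℝ) ≤ 2 * Real.pi * z.im → 0 < ε → 4 * ε < 1 →
      1 ≤ ε * 2.718 ^ m → ‖S‖ ≤ ε / (1 - 4 * ε) := by
    intro m ε hm hε hε1 hεm
    have hqε : ‖q‖ ≤ ε := by
      rw [hq, norm_cexp_two_pi_I_mul, Real.exp_neg, inv_le_comm₀ (Real.exp_pos _) hε]
      have he : (2.718 : ℝ) ^ m ≤ Real.exp (2 * Real.pi * z.im) := by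
        refine le_trans ?_ (Real.exp_le_exp.2 hm)
        rw [← Real.exp_one_pow]
        have := Real.exp_one_gt_d9
        gcongr
        linarith
      refine le_trans ?_ he
      rw [inv_le_iff_one_le_mul₀ hε]
      linarith
    refine (norm_tsum_sigma_one_mul_pow_le (by linarith)).trans ?_
    gcongr
  -- `2π · 0.86 > 5` and `e⁻⁵ < 0.0068`.
  have hSlow : ‖S‖ ≤ 7 / 1000 :=
    (hSle 5 (0.0068 : ℝ) (by push_cast; nlinarith) (by norm_num) (by norm_num)
      (by norm_num)).trans (by norm_num)
  have hp3 : Real.pi ^ 2 ≤ 9.87 := by nlinarith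
  have hSlow' : 8 * Real.pi ^ 2 * ‖S‖ ≤ 0.56 := by
    calc _ ≤ 8 * 9.87 * (7 / 1000 : ℝ) := by gcongr
      _ ≤ _ := by norm_num
  rcases le_total (Real.pi ^ 2 / 3) (Real.pi / z.im) with h | h
  · rw [abs_of_nonpos (by linarith)] at hn
    nlinarith
  · rw [abs_of_nonneg (by linarith)] at hn
    rcases le_total z.im 1.5 with h3 | h3
    · have : Real.pi / 1.5 ≤ Real.pi / z.im := by gcongr
      have e : Real.pi / 1.5 = Real.pi * (2 / 3) := by ring
      rw [e] at this
      nlinarith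
    -- The tight case: up to the tiny `S`, the claim is `π²/3 < 2π/y`, that is `y < 6/π ≈ 1.9099`.
    -- The sharper bound on `S` uses `2π · 1.5 > 9`.
    · have : Real.pi / 1.9 ≤ Real.pi / z.im := by gcongr
      have e : Real.pi / 1.9 = Real.pi * (10 / 19) := by ring
      rw [e] at this
      have hS2 : ‖S‖ ≤ 0.0001242 :=
        (hSle 9 (0.0001240 : ℝ) (by push_cast; nlinarith) (by norm_num) (by norm_num)
          (by norm_num)).trans (by norm_num)
      have hS3 : 8 * Real.pi ^ 2 * ‖S‖ ≤ 0.00981 := by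
        calc _ ≤ 8 * 9.87 * (0.0001242 : ℝ) := by gcongr
          _ ≤ _ := by norm_num
      nlinarith

end EisensteinSeries

end

/-! ### Primary factors and sine products for the rows of the lattice. -/

section

open Filter Topology Finset Complex Asymptotics

namespace Complex

/-- The primary factor of genus two is `1 + O(w³)`. -/
theorem one_sub_mul_exp_sub_one_isBigO :
    (fun w : ℂ => (1 - w) * exp (w + w ^ 2 / 2) - 1) =O[𝓝 0] fun w => w ^ 3 := by
  have hv : Tendsto (fun w : ℂ => w + w ^ 2 / 2) (𝓝 0) (𝓝 0) := by
    have : Continuous fun w : ℂ => w + w ^ 2 / 2 := by fun_prop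
    simpa using this.tendsto 0
  have h1 := (Complex.exp_sub_sum_range_isBigO_pow 3).comp_tendsto hv
  have hvO : (fun w : ℂ => w + w ^ 2 / 2) =O[𝓝 0] fun w => w := by
    have : (fun w : ℂ => w + w ^ 2 / 2) = fun w => (1 + w / 2) * w := by ext; ring
    rw [this]
    have hb : (fun w : ℂ => 1 + w / 2) =O[𝓝 0] fun _ => (1 : ℂ) :=
      (ContinuousAt.tendsto (by fun_prop : ContinuousAt (fun w : ℂ => 1 + w / 2) 0)).isBigO_one ℂ
    simpa using hb.mul (isBigO_refl (fun w : ℂ => w) (𝓝 0))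
  have h2 := h1.trans (hvO.pow 3)
  have hb : (fun w : ℂ => 1 - w) =O[𝓝 0] fun _ => (1 : ℂ) :=
    (ContinuousAt.tendsto (by fun_prop : ContinuousAt (fun w : ℂ => 1 - w) 0)).isBigO_one ℂ
  have hc : (fun w : ℂ => -1 / 2 - 3 * w / 8 - w ^ 2 / 8) =O[𝓝 0] fun _ => (1 : ℂ) :=
    (ContinuousAt.tendsto
      (by fun_prop : ContinuousAt (fun w : ℂ => -1 / 2 - 3 * w / 8 - w ^ 2 / 8) 0)).isBigO_one ℂ
  have h3 := (hb.mul h2).add (hc.mul (isBigO_refl (fun w : ℂ => w ^ 3) (𝓝 0)))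
  simp only [one_mul] at h3
  refine h3.congr_left fun w => ?_
  simp only [Function.comp_apply, Finset.sum_range_succ, Finset.sum_range_zero, Nat.factorial]
  push_cast
  ring

theorem tendsto_mul_prod_one_sub_sq_div (x : ℂ) :
    Tendsto (fun N : ℕ => x * ∏ j ∈ range N, (1 - x ^ 2 / ((j : ℂ) + 1) ^ 2)) atTop
      (𝓝 (sin (Real.pi * x) / Real.pi)) := by
  have hpi : (Real.pi : ℂ) ≠ 0 := by exact_mod_cast Real.pi_ne_zero
  refine ((tendsto_euler_sin_prod x).div_const (Real.pi : ℂ)).congr fun N => ?_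
  field_simp

theorem prod_Icc_succ_symm {M : Type*} [CommMonoid M] (f : ℤ → M) (N : ℕ) :
    ∏ n ∈ Icc (-((N + 1 : ℕ) : ℤ)) ((N + 1 : ℕ) : ℤ), f n =
      (∏ n ∈ Icc (-(N : ℤ)) N, f n) * (f (N + 1) * f (-(N + 1))) := by
  have h : Icc (-((N + 1 : ℕ) : ℤ)) ((N + 1 : ℕ) : ℤ) =
      insert ((N : ℤ) + 1) (insert (-((N : ℤ) + 1)) (Icc (-(N : ℤ)) N)) := by
    ext x
    simp only [mem_Icc, mem_insert]
    push_cast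
    omega
  rw [h, prod_insert, prod_insert, ← mul_assoc, mul_comm]
  · simp
  · simp only [mem_insert, mem_Icc]
    omega


theorem hasProd_tendsto_Icc_neg {f : ℤ → ℂ} {a : ℂ} (h : HasProd f a) :
    Tendsto (fun N : ℕ => ∏ n ∈ Icc (-(N : ℤ)) N, f n) atTop (𝓝 a) :=
  (show Tendsto (fun s : Finset ℤ => ∏ n ∈ s, f n) atTop (𝓝 a) by simpa [HasProd] using h).comp
    Finset.tendsto_Icc_neg

theorem summable_div_add_intCast_sq (u w : ℂ) :
    Summable fun n : ℤ => u ^ 2 / (w + n) ^ 2 := by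
  have := (EisensteinSeries.linear_right_summable w 1 (le_refl 2)).mul_left (u ^ 2)
  refine this.congr fun n => ?_
  simp [div_eq_mul_inv]

theorem multipliable_one_sub_div_add_intCast_sq (u w : ℂ) :
    Multipliable fun n : ℤ => 1 - u ^ 2 / (w + n) ^ 2 := by
  have := multipliable_one_add_of_summable (summable_div_add_intCast_sq u w).neg.norm
  simpa [sub_eq_add_neg] using this

/-- The factor at `n = 0` is `1`, since `u ^ 2 / 0 = 0`; those at `n` and `-n` coincide. -/
theorem sq_mul_prod_Icc_one_sub_div_sq (u : ℂ) (N : ℕ) :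
    u ^ 2 * ∏ n ∈ Icc (-(N : ℤ)) N, (1 - u ^ 2 / (n : ℂ) ^ 2) =
      (u * ∏ j ∈ range N, (1 - u ^ 2 / ((j : ℂ) + 1) ^ 2)) ^ 2 := by
  induction N with
  | zero => simp
  | succ N ih =>
    rw [prod_Icc_succ_symm, ← mul_assoc, ih, prod_range_succ]
    push_cast
    ring

/-- Each factor is `(w + n - u)(w + n + u) / (w + n)²`; pairing `n` with `-n` produces partial Euler
sine products at `w - u`, `w + u` and `w`. -/
theorem prod_Icc_one_sub_div_add_sq (u w : ℂ) (hw : ∀ n : ℤ, w + n ≠ 0) (N : ℕ) :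
    (∏ n ∈ Icc (-(N : ℤ)) N, (1 - u ^ 2 / (w + n) ^ 2)) *
        (w * ∏ j ∈ range N, (1 - w ^ 2 / ((j : ℂ) + 1) ^ 2)) ^ 2 =
      ((w - u) * ∏ j ∈ range N, (1 - (w - u) ^ 2 / ((j : ℂ) + 1) ^ 2)) *
        ((w + u) * ∏ j ∈ range N, (1 - (w + u) ^ 2 / ((j : ℂ) + 1) ^ 2)) := by
  induction N with
  | zero =>
    have h0 : w ≠ 0 := by simpa using hw 0
    simp
    field_simp
    ring
  | succ N ih =>
    have e : (1 - u ^ 2 / (w + ((N : ℂ) + 1)) ^ 2) * (1 - u ^ 2 / (w + -((N : ℂ) + 1)) ^ 2) *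
        (1 - w ^ 2 / ((N : ℂ) + 1) ^ 2) ^ 2 =
        (1 - (w - u) ^ 2 / ((N : ℂ) + 1) ^ 2) * (1 - (w + u) ^ 2 / ((N : ℂ) + 1) ^ 2) := by
      have h1 : w + ((N : ℂ) + 1) ≠ 0 := by have := hw (N + 1); push_cast at this; exact this
      have h2 : w + -((N : ℂ) + 1) ≠ 0 := by have := hw (-(N + 1)); push_cast at this; exact this
      have h3 : (N : ℂ) + 1 ≠ 0 := by exact_mod_cast N.succ_ne_zero
      generalize (N : ℂ) + 1 = a at *
      field_simp
      ring
    rw [prod_Icc_succ_symm]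
    simp only [prod_range_succ]
    push_cast
    linear_combination (((1 - u ^ 2 / (w + ((N : ℂ) + 1)) ^ 2) *
      (1 - u ^ 2 / (w + -((N : ℂ) + 1)) ^ 2) * (1 - w ^ 2 / ((N : ℂ) + 1) ^ 2) ^ 2)) * ih +
      (((w - u) * ∏ j ∈ range N, (1 - (w - u) ^ 2 / ((j : ℂ) + 1) ^ 2)) *
        ((w + u) * ∏ j ∈ range N, (1 - (w + u) ^ 2 / ((j : ℂ) + 1) ^ 2))) * e

theorem sq_mul_tprod_one_sub_div_intCast_sq (u : ℂ) :
    u ^ 2 * ∏' n : ℤ, (1 - u ^ 2 / (0 + (n : ℂ)) ^ 2) = (sin (Real.pi * u) / Real.pi) ^ 2 := by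
  have h1 := (hasProd_tendsto_Icc_neg
    (multipliable_one_sub_div_add_intCast_sq u 0).hasProd).const_mul (u ^ 2)
  refine tendsto_nhds_unique h1 (((tendsto_mul_prod_one_sub_sq_div u).pow 2).congr fun N => ?_)
  simp only [zero_add]
  rw [sq_mul_prod_Icc_one_sub_div_sq]

theorem tprod_one_sub_div_add_intCast_sq (u w : ℂ) (hw : ∀ n : ℤ, w + n ≠ 0) :
    (∏' n : ℤ, (1 - u ^ 2 / (w + n) ^ 2)) =
      sin (Real.pi * (w - u)) * sin (Real.pi * (w + u)) / sin (Real.pi * w) ^ 2 := by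
  have hpi : (Real.pi : ℂ) ≠ 0 := by exact_mod_cast Real.pi_ne_zero
  have hs : sin (Real.pi * w) ≠ 0 := by
    refine sin_ne_zero_iff.2 fun k hk => hw (-k) ?_
    rw [mul_comm (k : ℂ)] at hk
    have := mul_left_cancel₀ hpi hk
    push_cast
    rw [this]
    ring
  have h1 := (hasProd_tendsto_Icc_neg
    (multipliable_one_sub_div_add_intCast_sq u w).hasProd).mul
    ((tendsto_mul_prod_one_sub_sq_div w).pow 2)
  have h2 := (tendsto_mul_prod_one_sub_sq_div (w - u)).mul (tendsto_mul_prod_one_sub_sq_div (w + u))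
  have := tendsto_nhds_unique (h1.congr (prod_Icc_one_sub_div_add_sq u w hw)) h2
  rw [eq_div_iff (pow_ne_zero 2 hs)]
  field_simp at this
  rw [mul_comm w] at this
  exact this

end Complex

end

/-! ### The sigma function as a theta function, and its periodic part. -/

section

open Filter Topology Finset Complex Asymptotics EisensteinSeries

namespace PeriodPair

theorem ω₁_ne_zero (L : PeriodPair) : L.ω₁ ≠ 0 := by
  simpa using L.indep.ne_zero 0

theorem ω₂_eq_tau_mul (L : PeriodPair) : L.ω₂ = L.tau * L.ω₁ := by
  rw [tau, div_mul_cancel₀ _ L.ω₁_ne_zero]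

theorem weierstrassSigma_eq (L : PeriodPair) (z : ℂ) :
    L.weierstrassSigma z =
      z * ∏' ω : L.lattice, (1 - z / ω) * exp (z / ω + (z / ω) ^ 2 / 2) := by
  have h : Function.mulSupport
      (fun ω : L.lattice => (1 - z / ω) * exp (z / ω + (z / ω) ^ 2 / 2)) ⊆ {ω | ω ≠ 0} := by
    intro ω hω h0
    rw [h0] at hω
    simp at hω
  rw [weierstrassSigma, ← tprod_subtype_eq_of_mulSupport_subset h]
  congr 1
  refine tprod_congr fun ω => ?_
  rw [div_pow, div_div, mul_comm (2 : ℂ)]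

/-- The factors are `1 + O(|ω|⁻³)`, and `|ω|⁻³` is summable over a lattice of rank two. -/
theorem multipliable_weierstrassSigma (L : PeriodPair) (z : ℂ) :
    Multipliable fun ω : L.lattice => (1 - z / ω) * exp (z / ω + (z / ω) ^ 2 / 2) := by
  have h0 : Tendsto (fun ω : L.lattice => z / (ω : ℂ)) cofinite (𝓝 0) := by
    have h1 : Tendsto (fun ω : L.lattice => ‖(ω : ℂ)‖) cofinite atTop :=
      tendsto_norm_comp_cofinite_atTop_of_isClosedEmbedding
        L.isClosed_lattice.isClosedEmbedding_subtypeVal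
    have h2 := (tendsto_inv_atTop_zero.comp h1).const_mul ‖z‖
    rw [mul_zero] at h2
    refine tendsto_zero_iff_norm_tendsto_zero.2 (h2.congr fun ω => ?_)
    simp [div_eq_mul_inv]
  have hs : Summable fun ω : L.lattice =>
      (1 - z / ω) * exp (z / ω + (z / ω) ^ 2 / 2) - 1 := by
    refine summable_of_isBigO
      ((ZLattice.summable_norm_pow_inv (L := L.lattice) 3 (by simp)).mul_left (‖z‖ ^ 3)) ?_
    refine (one_sub_mul_exp_sub_one_isBigO.comp_tendsto h0).trans (IsBigO.of_norm_le fun ω => ?_)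
    simp [div_eq_mul_inv, mul_pow]
  have := multipliable_one_add_of_summable hs.norm
  simpa using this

/-- Multiplying the factors of `ω` and `-ω` in the product of the sigma function removes the
linear terms of the exponents. -/
theorem hasProd_weierstrassSigma_sq (L : PeriodPair) (z : ℂ) :
    HasProd (fun ω : L.lattice => (1 - (z / ω) ^ 2) * exp ((z / ω) ^ 2))
      ((∏' ω : L.lattice, (1 - z / ω) * exp (z / ω + (z / ω) ^ 2 / 2)) ^ 2) := by
  have h1 := (L.multipliable_weierstrassSigma z).hasProd
  have h2 := (Equiv.neg L.lattice).hasProd_iff.2 h1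
  rw [sq]
  refine (h1.mul h2).congr_fun fun ω => ?_
  simp only [Function.comp_apply, Equiv.neg_apply, NegMemClass.coe_neg, div_neg]
  rw [mul_mul_mul_comm, ← exp_add]
  ring_nf

/-- The square of the sigma function, as a function of `u = z / ω₁`, without the factor
`exp (u ^ 2 * G2 τ)`. -/
noncomputable def sqTheta (L : PeriodPair) (τ : UpperHalfPlane) (u : ℂ) : ℂ :=
  (L.weierstrassSigma (L.ω₁ * u) / L.ω₁) ^ 2 * exp (-(u ^ 2 * G2 τ))

theorem hasProd_prod_weierstrassSigma_sq (L : PeriodPair) (τ : UpperHalfPlane)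
    (hτ : (τ : ℂ) = L.tau) (u : ℂ) :
    HasProd (fun p : ℤ × ℤ => (1 - u ^ 2 / (p.1 * (τ : ℂ) + p.2) ^ 2) *
        exp (u ^ 2 * ((p.1 * (τ : ℂ) + p.2) ^ 2)⁻¹))
      ((∏' ω : L.lattice, (1 - L.ω₁ * u / ω) *
        exp (L.ω₁ * u / ω + (L.ω₁ * u / ω) ^ 2 / 2)) ^ 2) := by
  have h := ((Equiv.prodComm ℤ ℤ).trans L.latticeEquivProd.symm.toEquiv).hasProd_iff.2
    (L.hasProd_weierstrassSigma_sq (L.ω₁ * u))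
  refine h.congr_fun fun p => ?_
  have e : ((L.latticeEquivProd.symm (p.2, p.1) : L.lattice) : ℂ) =
      L.ω₁ * (p.1 * (τ : ℂ) + p.2) := by
    rw [latticeEquiv_symm_apply, L.ω₂_eq_tau_mul, hτ]
    ring
  have e' : L.ω₁ * u / ((L.latticeEquivProd.symm (p.2, p.1) : L.lattice) : ℂ) =
      u / (p.1 * (τ : ℂ) + p.2) := by
    rw [e, mul_div_mul_left _ _ L.ω₁_ne_zero]
  change _ = (1 - (L.ω₁ * u / ((L.latticeEquivProd.symm (p.2, p.1) : L.lattice) : ℂ)) ^ 2) *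
    exp ((L.ω₁ * u / ((L.latticeEquivProd.symm (p.2, p.1) : L.lattice) : ℂ)) ^ 2)
  rw [e', div_pow, ← div_eq_mul_inv]

theorem hasProd_row (τ : UpperHalfPlane) (u : ℂ) (m : ℤ) :
    HasProd (fun n : ℤ => (1 - u ^ 2 / (m * (τ : ℂ) + n) ^ 2) *
        exp (u ^ 2 * ((m * (τ : ℂ) + n) ^ 2)⁻¹))
      ((∏' n : ℤ, (1 - u ^ 2 / (m * (τ : ℂ) + n) ^ 2)) * exp (u ^ 2 * e2Summand m τ)) := by
  refine (multipliable_one_sub_div_add_intCast_sq u _).hasProd.mul ?_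
  have h := ((e2Summand_summable m τ).hasSum.mul_left (u ^ 2)).cexp
  refine h.congr_fun fun n => ?_
  simp [eisSummand]

/-- Up to factors that do not depend on `u`, the square of the sigma function is the limit of
squares of finite products of sines. -/
theorem exists_tendsto_sqTheta (L : PeriodPair) (τ : UpperHalfPlane) (hτ : (τ : ℂ) = L.tau) :
    ∃ c : ℕ → ℂ, ∀ u : ℂ, Tendsto
      (fun N : ℕ => c N * (∏ m ∈ Icc (-(N : ℤ)) N, sin (Real.pi * (u + m * (τ : ℂ)))) ^ 2) atTop
      (𝓝 (L.sqTheta τ u)) := by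
  classical
  -- At `m = 0` the sines give `-sin² (π u)`, whence the minus sign; this row also absorbs the
  -- factor `u²` of `σ²`.
  let d : ℤ → ℂ := fun m =>
    if m = 0 then -(1 / Real.pi ^ 2) else 1 / sin (Real.pi * (m * (τ : ℂ))) ^ 2
  refine ⟨fun N => (-1) * ∏ m ∈ Icc (-(N : ℤ)) N, d m, fun u => ?_⟩
  have h1 := HasProd.prod_fiberwise (L.hasProd_prod_weierstrassSigma_sq τ hτ u) (hasProd_row τ u)
  have h2 := hasProd_tendsto_Icc_neg ((hasProd_ite_eq (0 : ℤ) (u ^ 2)).mul h1)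
  -- `G2` is the limit of sums over symmetric ranges of rows, so the partial products are taken over
  -- the same ranges.
  have h3 : Tendsto (fun N : ℕ => exp (-(u ^ 2 * ∑ m ∈ Icc (-(N : ℤ)) N, e2Summand m τ))) atTop
      (𝓝 (exp (-(u ^ 2 * G2 τ)))) := by
    have := hasSum_e2Summand_symmetricIcc τ
    rw [← G2_eq_tsum_cexp, HasSum, SummationFilter.symmetricIcc_eq_map_Icc_nat,
      tendsto_map'_iff] at this
    exact (continuous_exp.tendsto _).comp (this.const_mul _).neg
  have h4 := h2.mul h3
  have e4 : u ^ 2 * (∏' ω : L.lattice, (1 - L.ω₁ * u / ω) *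
        exp (L.ω₁ * u / ω + (L.ω₁ * u / ω) ^ 2 / 2)) ^ 2 * exp (-(u ^ 2 * G2 τ)) =
      L.sqTheta τ u := by
    rw [sqTheta, weierstrassSigma_eq, mul_assoc L.ω₁, mul_div_cancel_left₀ _ L.ω₁_ne_zero, mul_pow]
  rw [e4] at h4
  refine h4.congr fun N => ?_
  have hrow : ∀ m : ℤ, (if m = 0 then u ^ 2 else 1) *
      ((∏' n : ℤ, (1 - u ^ 2 / (m * (τ : ℂ) + n) ^ 2)) * exp (u ^ 2 * e2Summand m τ)) =
      d m * (sin (Real.pi * (m * (τ : ℂ) - u)) * sin (Real.pi * (u + m * (τ : ℂ)))) *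
        exp (u ^ 2 * e2Summand m τ) := by
    intro m
    rw [← mul_assoc]
    congr 1
    rcases eq_or_ne m 0 with rfl | hm
    · have := sq_mul_tprod_one_sub_div_intCast_sq u
      simp only [d, if_true, Int.cast_zero, zero_mul, zero_sub, add_zero, mul_neg, sin_neg]
      rw [this]
      ring
    · have hw : ∀ n : ℤ, (m * (τ : ℂ)) + n ≠ 0 := by
        intro n hn
        have := congrArg Complex.im hn
        simp [hm, τ.im_ne_zero] at this
      simp only [d, if_neg hm, one_mul]
      rw [tprod_one_sub_div_add_intCast_sq u _ hw, add_comm u]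
      ring
  rw [prod_congr rfl fun m _ => hrow m]
  rw [prod_mul_distrib, prod_mul_distrib, prod_mul_distrib, ← exp_sum, ← mul_sum, mul_assoc,
    ← exp_add, add_neg_cancel, exp_zero, mul_one]
  -- Reflect `m ↦ -m`; the number `2N + 1` of sign changes is odd.
  have hneg : ∏ m ∈ Icc (-(N : ℤ)) N, sin (Real.pi * (m * (τ : ℂ) - u)) =
      -∏ m ∈ Icc (-(N : ℤ)) N, sin (Real.pi * (u + m * (τ : ℂ))) := by
    have hr : ∏ m ∈ Icc (-(N : ℤ)) N, sin (Real.pi * (m * (τ : ℂ) - u)) =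
        ∏ m ∈ Icc (-(N : ℤ)) N, -sin (Real.pi * (u + m * (τ : ℂ))) := by
      refine prod_nbij' (fun m => -m) (fun m => -m) ?_ ?_ ?_ ?_ ?_
      · intro m hm; simp only [mem_Icc] at *; omega
      · intro m hm; simp only [mem_Icc] at *; omega
      · intro m _; simp
      · intro m _; simp
      · intro m _
        rw [← sin_neg]
        congr 1
        push_cast
        ring
    rw [hr, prod_neg]
    have : (Icc (-(N : ℤ)) N).card = 2 * N + 1 := by rw [Int.card_Icc]; omega
    rw [this, pow_succ, pow_mul]
    simp
  rw [hneg]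
  ring

theorem sqTheta_add_one (L : PeriodPair) (τ : UpperHalfPlane) (hτ : (τ : ℂ) = L.tau) (u : ℂ) :
    L.sqTheta τ (u + 1) = L.sqTheta τ u := by
  obtain ⟨c, hc⟩ := L.exists_tendsto_sqTheta τ hτ
  refine tendsto_nhds_unique ((hc (u + 1)).congr fun N => ?_) (hc u)
  congr 1
  rw [← prod_pow, ← prod_pow]
  refine prod_congr rfl fun m _ => ?_
  have : (Real.pi : ℂ) * (u + 1 + m * (τ : ℂ)) = Real.pi * (u + m * (τ : ℂ)) + Real.pi := by ring
  rw [this, sin_add_pi, neg_sq]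

/-- High in the upper half plane one exponential of the sine dominates. This controls the end
factors in `prod_Icc_sin_add_tau`. -/
theorem tendsto_exp_mul_sin (τ : UpperHalfPlane) (v : ℂ) :
    Tendsto (fun N : ℕ => exp (Real.pi * I * (N * τ)) * sin (Real.pi * (v + N * τ))) atTop
      (𝓝 (I / 2 * exp (-(Real.pi * I * v)))) := by
  have hq : ‖exp (2 * Real.pi * I * τ)‖ < 1 := UpperHalfPlane.norm_exp_two_pi_I_lt_one τ
  have h := ((tendsto_pow_atTop_nhds_zero_of_norm_lt_one hq).const_mul
    (exp (Real.pi * I * v))).const_sub (exp (-(Real.pi * I * v)))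
  rw [mul_zero, sub_zero] at h
  refine (h.const_mul (I / 2)).congr fun N => ?_
  have e1 : exp (-(Real.pi * (v + N * τ)) * I) =
      exp (-(Real.pi * I * v)) * (exp (Real.pi * I * (N * τ)))⁻¹ := by
    rw [← exp_neg, ← exp_add]; congr 1; ring
  have e2 : exp (Real.pi * (v + N * τ) * I) = exp (Real.pi * I * v) * exp (Real.pi * I * (N * τ)) := by
    rw [← exp_add]; congr 1; ring
  have e3 : exp (2 * Real.pi * I * τ) ^ N = exp (Real.pi * I * (N * τ)) ^ 2 := by
    rw [← exp_nat_mul, ← exp_nat_mul]; congr 1; push_cast; ring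
  rw [Complex.sin, e1, e2, e3]
  have := exp_ne_zero (Real.pi * I * (N * τ))
  field_simp

/-- Shifting by `τ` moves the window of rows by one, so only the two end sines change. -/
theorem prod_Icc_sin_add_tau (τ u : ℂ) (N : ℕ) :
    (∏ m ∈ Icc (-(N : ℤ)) N, sin (Real.pi * (u + τ + m * τ))) * sin (Real.pi * (u - N * τ)) =
      (∏ m ∈ Icc (-(N : ℤ)) N, sin (Real.pi * (u + m * τ))) *
        sin (Real.pi * (u + τ + N * τ)) := by
  induction N with
  | zero => simp [mul_comm]
  | succ N ih =>
    rw [prod_Icc_succ_symm, prod_Icc_succ_symm]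
    push_cast
    have e1 : u + τ + -((N : ℂ) + 1) * τ = u - N * τ := by ring
    have e2 : u + -((N : ℂ) + 1) * τ = u - ((N : ℂ) + 1) * τ := by ring
    have e3 : u + ((N : ℂ) + 1) * τ = u + τ + N * τ := by ring
    rw [e1, e2, e3]
    linear_combination (sin (Real.pi * (u + τ + ((N : ℂ) + 1) * τ)) *
      sin (Real.pi * (u - ((N : ℂ) + 1) * τ))) * ih

theorem sqTheta_add_tau (L : PeriodPair) (τ : UpperHalfPlane) (hτ : (τ : ℂ) = L.tau) (u : ℂ) :
    L.sqTheta τ (u + τ) = exp (-(2 * Real.pi * I * (2 * u + τ))) * L.sqTheta τ u := by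
  obtain ⟨c, hc⟩ := L.exists_tendsto_sqTheta τ hτ
  -- Both end sines carry the same normalisation and have nonzero limits, whose ratio is the
  -- multiplier.
  have h1 := (hc (u + τ)).mul ((tendsto_exp_mul_sin τ (-u)).pow 2)
  have h2 := (hc u).mul ((tendsto_exp_mul_sin τ (u + τ)).pow 2)
  have h3 := tendsto_nhds_unique (h1.congr fun N => ?_) h2
  · rw [mul_neg, neg_neg, mul_pow, mul_pow, ← exp_nat_mul, ← exp_nat_mul, div_pow, I_sq] at h3
    have e : exp (((2 : ℕ) : ℂ) * -(Real.pi * I * (u + τ))) =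
        exp (-(2 * Real.pi * I * (2 * u + τ))) * exp (((2 : ℕ) : ℂ) * (Real.pi * I * u)) := by
      rw [← exp_add]; congr 1; push_cast; ring
    rw [e] at h3
    have := exp_ne_zero (((2 : ℕ) : ℂ) * (Real.pi * I * u))
    refine mul_right_cancel₀ this ?_
    linear_combination (-4) * h3
  · have e : sin (Real.pi * (-u + N * τ)) = -sin (Real.pi * (u - N * τ)) := by
      rw [← sin_neg]; congr 1; ring
    rw [e]
    have := prod_Icc_sin_add_tau τ u N
    calc _ = c N * exp (Real.pi * I * (N * τ)) ^ 2 *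
          ((∏ m ∈ Icc (-(N : ℤ)) N, sin (Real.pi * (u + τ + m * τ))) *
            sin (Real.pi * (u - N * τ))) ^ 2 := by ring
      _ = _ := by rw [this]; ring

/-- The modulus of the square of the sigma function, divided by the exponential of the quadratic
form that governs its growth. -/
noncomputable def reducedNorm (L : PeriodPair) (τ : UpperHalfPlane) (u : ℂ) : ℝ :=
  ‖L.sqTheta τ u‖ * Real.exp (-(2 * Real.pi * u.im ^ 2 / τ.im))

theorem reducedNorm_add_one (L : PeriodPair) (τ : UpperHalfPlane) (hτ : (τ : ℂ) = L.tau) (u : ℂ) :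
    L.reducedNorm τ (u + 1) = L.reducedNorm τ u := by
  rw [reducedNorm, L.sqTheta_add_one τ hτ, reducedNorm]
  simp

/-- The multiplier has modulus `exp (2π (2 Im u + Im τ))`, exactly the growth of the Gaussian
weight. -/
theorem reducedNorm_add_tau (L : PeriodPair) (τ : UpperHalfPlane) (hτ : (τ : ℂ) = L.tau) (u : ℂ) :
    L.reducedNorm τ (u + τ) = L.reducedNorm τ u := by
  rw [reducedNorm, L.sqTheta_add_tau τ hτ, reducedNorm, norm_mul, norm_exp, mul_right_comm,
    ← Real.exp_add, mul_comm]
  congr 2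
  have := τ.im_ne_zero
  simp
  field_simp
  ring

theorem reducedNorm_add_int (L : PeriodPair) (τ : UpperHalfPlane) (hτ : (τ : ℂ) = L.tau) (u : ℂ)
    (n m : ℤ) : L.reducedNorm τ (u + (n + m * τ)) = L.reducedNorm τ u := by
  have p1 : Function.Periodic (L.reducedNorm τ) 1 := L.reducedNorm_add_one τ hτ
  have p2 : Function.Periodic (L.reducedNorm τ) τ := L.reducedNorm_add_tau τ hτ
  have h1 := p1.int_mul n
  have h2 := p2.int_mul m
  rw [mul_one] at h1
  rw [← add_assoc, h2, h1]

theorem norm_weierstrassSigma_sq (L : PeriodPair) (τ : UpperHalfPlane) (u : ℂ) :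
    ‖L.weierstrassSigma (L.ω₁ * u)‖ ^ 2 = ‖L.ω₁‖ ^ 2 * L.reducedNorm τ u *
      Real.exp (((G2 τ - (Real.pi / τ.im : ℝ)) * u ^ 2).re + Real.pi / τ.im * ‖u‖ ^ 2) := by
  have h1 : ‖L.ω₁‖ ≠ 0 := norm_ne_zero_iff.2 L.ω₁_ne_zero
  rw [reducedNorm, sqTheta, norm_mul, norm_pow, norm_div, norm_exp]
  have e : ((G2 τ - (Real.pi / τ.im : ℝ)) * u ^ 2).re + Real.pi / τ.im * ‖u‖ ^ 2 =
      -(-(u ^ 2 * G2 τ)).re + 2 * Real.pi * u.im ^ 2 / τ.im := by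
    rw [← normSq_eq_norm_sq, normSq_apply]
    simp only [sq, sub_mul, sub_re, mul_re, neg_re, mul_im, ofReal_re, ofReal_im]
    ring
  rw [e, Real.exp_add, Real.exp_neg, Real.exp_neg]
  field_simp

end PeriodPair

end

/-! ### Reduction to the parallelogram and the growth estimate. -/

namespace PeriodPair

open EisensteinSeries

/-- Every complex number is congruent modulo the lattice to a point of the centred
parallelogram. -/
theorem exists_centredParallelogram (L : PeriodPair) (h : 0 < L.tau.im) (u : ℂ) :
    ∃ n m : ℤ, ∃ s t : ℝ, |s| ≤ 1 / 2 ∧ |t| ≤ 1 / 2 ∧ u = (s + t * L.tau) + (n + m * L.tau) := by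
  set t := u.im / L.tau.im with ht
  set x := u.re - t * L.tau.re with hx
  refine ⟨round x, round t, x - round x, t - round t, abs_sub_round x, abs_sub_round t, ?_⟩
  push_cast
  have e : u = x + t * L.tau := by
    apply Complex.ext
    · simp [hx]
    · simp [ht, h.ne']
  linear_combination e

theorem IsReduced.im_ge {L : PeriodPair} (h : L.IsReduced) : 0.86 ≤ L.tau.im := by
  obtain ⟨h0, h1, h2, h3⟩ := h
  have h4 : 1 ≤ L.tau.re * L.tau.re + L.tau.im * L.tau.im := by
    rw [← Complex.normSq_apply, Complex.normSq_eq_norm_sq]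
    nlinarith
  by_contra hlt
  push Not at hlt
  nlinarith

theorem norm_tau_le_two {L : PeriodPair} (h : L.IsReduced) (h' : L.tau.im ≤ 1.9) :
    ‖L.tau‖ ≤ 2 := by
  obtain ⟨h0, h1, h2, h3⟩ := h
  refine abs_le_of_sq_le_sq' (?_ : ‖L.tau‖ ^ 2 ≤ 2 ^ 2) (by norm_num) |>.2
  rw [← Complex.normSq_eq_norm_sq, Complex.normSq_apply]
  nlinarith

theorem norm_weierstrassSigma_le {L : PeriodPair} (h : L.IsReduced) (h' : L.tau.im ≤ 1.9)
    {c : ℝ} (hc : c * ‖L.ω₁‖ ^ 2 ≤ 1 / 1024) {z : ℂ} (hz : 128 * ‖L.ω₁‖ ≤ ‖z‖) :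
    ∃ z₀ ∈ L.centredParallelogram, z - z₀ ∈ L.lattice ∧
      ‖L.weierstrassSigma z₀‖ * Real.exp (c * ‖z‖ ^ 2) ≤ ‖L.weierstrassSigma z‖ := by
  have hw := L.ω₁_ne_zero
  have hw' : 0 < ‖L.ω₁‖ := norm_pos_iff.2 hw
  set τ : UpperHalfPlane := ⟨L.tau, h.1⟩
  have hτ : (τ : ℂ) = L.tau := rfl
  have hτi : τ.im = L.tau.im := rfl
  obtain ⟨u, rfl⟩ : ∃ u, z = L.ω₁ * u := ⟨z / L.ω₁, by field_simp⟩
  obtain ⟨n, m, s, t, hs, ht, hu⟩ := L.exists_centredParallelogram h.1 u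
  set v : ℂ := s + t * L.tau with hv
  refine ⟨L.ω₁ * v, ⟨s, abs_le.1 hs, t, abs_le.1 ht, ?_⟩, ?_, ?_⟩
  · rw [L.ω₂_eq_tau_mul, hv]
    ring
  · rw [mem_lattice]
    refine ⟨n, m, ?_⟩
    rw [L.ω₂_eq_tau_mul, hu]
    ring
  · have hG := norm_G2_sub_pi_div_im_le (z := τ) h.im_ge h'
    have hN : L.reducedNorm τ u = L.reducedNorm τ v := by
      rw [hu, ← hτ, L.reducedNorm_add_int τ hτ]
    set G := G2 τ - (Real.pi / τ.im : ℝ)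
    set a := Real.pi / τ.im with ha
    have hvn : ‖v‖ ≤ 3 / 2 := by
      calc ‖v‖ ≤ ‖(s : ℂ)‖ + ‖(t * L.tau : ℂ)‖ := norm_add_le _ _
        _ = |s| + |t| * ‖L.tau‖ := by simp
        _ ≤ 1 / 2 + 1 / 2 * 2 := by
          gcongr
          exact norm_tau_le_two h h'
        _ = 3 / 2 := by norm_num
    have ha4 : a ≤ 3.7 := by
      have := h.im_ge
      rw [ha, hτi, div_le_iff₀ h.1]
      nlinarith [Real.pi_lt_d4]
    have hun : 128 ≤ ‖u‖ := by
      rw [norm_mul, mul_comm] at hz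
      exact le_of_mul_le_mul_left hz hw'
    have hre : ∀ w : ℂ, |(G * w ^ 2).re| ≤ ‖G‖ * ‖w‖ ^ 2 := fun w =>
      (Complex.abs_re_le_norm _).trans (by rw [norm_mul, norm_pow])
    have hQu : 1 / 200 * ‖u‖ ^ 2 ≤ (G * u ^ 2).re + a * ‖u‖ ^ 2 := by
      have := (abs_le.1 (hre u)).1
      nlinarith [sq_nonneg ‖u‖]
    -- `(‖G‖ + a) ‖v‖² ≤ 7.4 · 9/4 < 17`.
    have hQv : (G * v ^ 2).re + a * ‖v‖ ^ 2 ≤ 17 := by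
      have h1 := (abs_le.1 (hre v)).2
      have h2 : ‖v‖ ^ 2 ≤ (3 / 2) ^ 2 := by gcongr
      have h3 : 0 ≤ ‖G‖ := norm_nonneg G
      nlinarith [sq_nonneg ‖v‖]
    have hcu : c * ‖L.ω₁ * u‖ ^ 2 ≤ 1 / 1024 * ‖u‖ ^ 2 := by
      rw [norm_mul, mul_pow, ← mul_assoc]
      gcongr
    have hN0 : 0 ≤ L.reducedNorm τ v := by
      unfold reducedNorm
      positivity
    refine (sq_le_sq₀ (by positivity) (by positivity)).1 ?_
    rw [mul_pow, norm_weierstrassSigma_sq L τ u, norm_weierstrassSigma_sq L τ v, hN,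
      ← Real.exp_nat_mul, mul_assoc, ← Real.exp_add]
    refine mul_le_mul_of_nonneg_left (Real.exp_le_exp.2 ?_) (by positivity)
    rw [Nat.cast_ofNat]
    change (G * v ^ 2).re + a * ‖v‖ ^ 2 + 2 * (c * ‖L.ω₁ * u‖ ^ 2) ≤ (G * u ^ 2).re + a * ‖u‖ ^ 2
    -- The choice of 128 and 1024: `128² (1/200 - 2/1024) > 17`.
    have : (128 : ℝ) ^ 2 ≤ ‖u‖ ^ 2 := by gcongr
    linarith

end PeriodPair

theorem proposition2p1 :
    ∃ r c : PeriodPair → ℝ,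
      IsEffectiveOn {L | L.IsReduced ∧ L.tau.im ≤ 1.9} r ∧
      IsEffectiveOn {L | L.IsReduced ∧ L.tau.im ≤ 1.9} c ∧
      ∀ L : PeriodPair, L.IsReduced → L.tau.im ≤ 1.9 →
        0 < r L ∧ 0 < c L ∧
        ∀ z : ℂ, r L ≤ ‖z‖ →
          ∃ z₀ ∈ L.centredParallelogram, z - z₀ ∈ L.lattice ∧
            ‖L.weierstrassSigma z₀‖ * Real.exp (c L * ‖z‖ ^ 2) ≤ ‖L.weierstrassSigma z‖ := by
  refine ⟨_, _, isEffectiveOn_radius _, isEffectiveOn_rate _, fun L h h' => ?_⟩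
  have hw : 0 < ‖L.ω₁‖ := norm_pos_iff.2 L.ω₁_ne_zero
  have hs := Complex.norm_le_abs_re_add_abs_im L.ω₁
  refine ⟨by linarith, by positivity, fun z hz => ?_⟩
  refine PeriodPair.norm_weierstrassSigma_le h h' ?_ (le_trans (by linarith) hz)
  have h1 : ‖L.ω₁‖ ^ 2 ≤ (1 + (|L.ω₁.re| + |L.ω₁.im|)) ^ 2 := by
    gcongr
    linarith
  rw [mul_assoc, one_div_mul_eq_div (_ ^ 2)]
  have h2 : ‖L.ω₁‖ ^ 2 / (1 + (|L.ω₁.re| + |L.ω₁.im|)) ^ 2 ≤ 1 :=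
    div_le_one_of_le₀ h1 (by positivity)
  linarith
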